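/- Let $\mathcal M=\langle\mathcal S,\mathcal A,\mathcal R,\mathcal P,\gamma\rangle$ be a finite Markov decision process with discount factor $0\le\gamma<1$, transition probabilities $\mathbb P_a(s,s')$ and finitely many reward levels $\mathcal R=[R_0,\dots,R_{M-1}]$; the reward of a transition $(s,a,s')$ may be random, with a law depending only on $(s,a,s')$. For a policy $\pi(a\mid s)$ let $V^\pi(s)=\mathbb E_\pi[\sum_{k\ge 0}\gamma^k r_{t+k+1}\mid s_t=s]$ and $Q^\pi(s,a)=\mathbb E[r(s_t,a_t,s_{t+1})+\gamma V^\pi(s_{t+1})\mid s_t=s,a_t=a]$, and let $Q^*(s,a)=\sup_\pi Q^\pi(s,a)$ be the optimal $Q$-function. Let $C=(c_{j,k})$ be an invertible $M\times M$ confusion matrix (nonnegative entries, every row sums to $1$), and put $\hat{\mathbf R}=C^{-1}\mathbf R$, where $\mathbf R=(R_0,\dots,R_{M-1})^{\top}$. An agent runs through states and actions $(s_t,a_t)_{t\ge 0}$. Its actions may be chosen in any randomised, history-dependent way. Instead of the true reward $r_t$ it observes a perturbed reward $\tilde r_t$. Let $(\mathcal F_t)$ be a filtration such that $\mathcal F_t$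 contains the history up to and including $(s_t,a_t)$, and suppose that for all $t$, $s'$, $j$, $k$ $$\mathbb P(s_{t+1}=s',\,r_t=R_j,\,\tilde r_t=R_k\mid\mathcal F_t)=\mathbb P_{a_t}(s_t,s')\;\mathbb P(r=R_j\mid s_t,a_t,s')\;c_{j,k}\quad\text{a.s.}$$ (If reward levels coincide in value, $r_t$ and $\tilde r_t$ are understood as labels of levels.) The surrogate reward is $\hat r_t=\hat R_k$ when $\tilde r_t=R_k$. Starting from an arbitrary $\mathcal F_0$-measurable $Q_0$, Q-learning with surrogate rewards updates $$Q_{t+1}(s_t,a_t)=(1-\alpha_t)\,Q_t(s_t,a_t)+\alpha_t\Big[\hat r_t+\gamma\max_{b\in\mathcal A}Q_t(s_{t+1},b)\Big]$$ and $Q_{t+1}(s,a)=Q_t(s,a)$ for $(s,a)\neq(s_t,a_t)$, where the step sizes $\alpha_t\ge 0$ are $\mathcal F_t$-measurable random variables. If with probability $1$ $$\sum_{t:\,(s_t,a_t)=(s,a)}\alpha_t=\infty\ \text{ for every }(s,a)\in\mathcal S\times\mathcal A,\qquad\text{and}\qquad\sum_t\alpha_t^2<\infty,$$ then with probability $1$,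 $Q_t(s,a)\to Q^*(s,a)$ for every $(s,a)\in\mathcal S\times\mathcal A$. -/

import Mathlib

open MeasureTheory Filter Topology
open scoped Matrix

namespace PerturbedQ

/-- A finite Markov decision process with state space `S`, action space `A`, and `M` reward levels.
After action `a` in state `s`, the next state is `s'` with probability `P s a s'`, and then the
reward is `R i` with probability `rewardProb s a s' i`.  A deterministic reward `r(s, a, s')` is
the case where every `rewardProb s a s'` is a point mass. -/
structure FiniteMDP (S A : Type*) [Fintype S] (M : ℕ) where
  /-- transition probabilities -/
  P : S → A → S → ℝ
  P_nonneg : ∀ s a s', 0 ≤ P s a s'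
  P_sum : ∀ s a, ∑ s', P s a s' = 1
  /-- the values of the reward levels -/
  R : Fin M → ℝ
  /-- law of the level of the true reward of a transition -/
  rewardProb : S → A → S → Fin M → ℝ
  rewardProb_nonneg : ∀ s a s' i, 0 ≤ rewardProb s a s' i
  rewardProb_sum : ∀ s a s', ∑ i, rewardProb s a s' i = 1
  /-- discount factor -/
  γ : ℝ
  γ_nonneg : 0 ≤ γ
  γ_le_one : γ ≤ 1

/-- A policy `π(a | s)`: for every state a probability distribution on the actions. -/
structure Policy (S A : Type*) [Fintype A] where
  prob : S → A → ℝ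
  prob_nonneg : ∀ s a, 0 ≤ prob s a
  prob_sum : ∀ s, ∑ a, prob s a = 1

section MDP

variable {S A : Type*} [Fintype S] [DecidableEq S] [Fintype A] {M : ℕ}

/-- Expected (true) reward of the action `a` in the state `s`. -/
def FiniteMDP.meanReward (m : FiniteMDP S A M) (s : S) (a : A) : ℝ :=
  ∑ s', m.P s a s' * ∑ i, m.rewardProb s a s' i * m.R i

/-- One-step transition matrix of the state process under the policy `π`. -/
def FiniteMDP.policyMatrix (m : FiniteMDP S A M) (π : Policy S A) : Matrix S S ℝ :=
  Matrix.of fun s s' => ∑ a, π.prob s a * m.P s a s'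

/-- `𝔼_π[r_{t+k+1} | s_t = s]`: the state `k` steps later has the law given by row `s` of the
`k`-th power of the transition matrix, there the action is drawn from `π`, and the reward
follows. -/
def FiniteMDP.expectedReward (m : FiniteMDP S A M) (π : Policy S A) (k : ℕ) (s : S) : ℝ :=
  ∑ x, (m.policyMatrix π ^ k) s x * ∑ a, π.prob x a * m.meanReward x a

/-- The value function `V^π(s) = 𝔼_π[∑ₖ γ^k r_{t+k+1} | s_t = s]`. -/
noncomputable def FiniteMDP.V (m : FiniteMDP S A M) (π : Policy S A) (s : S) : ℝ :=
  ∑' k : ℕ, m.γ ^ k * m.expectedReward π k s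

/-- The action-value function `Q^π(s, a) = 𝔼[r_t + γ V^π(s_{t+1}) | s_t = s, a_t = a]`. -/
noncomputable def FiniteMDP.Q (m : FiniteMDP S A M) (π : Policy S A) (s : S) (a : A) : ℝ :=
  m.meanReward s a + m.γ * ∑ s', m.P s a s' * m.V π s'

/-- The optimal action-value function `Q*(s, a) = sup_π Q^π(s, a)`. -/
noncomputable def FiniteMDP.optimalQ (m : FiniteMDP S A M) (s : S) (a : A) : ℝ :=
  ⨆ π : Policy S A, m.Q π s a

end MDP

/-- The surrogate rewards `R̂ = C⁻¹ R`: entry `k` is the reward that is used when level `k` is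
observed. -/
noncomputable def surrogate {M : ℕ} (C : Matrix (Fin M) (Fin M) ℝ) (R : Fin M → ℝ) :
    Fin M → ℝ :=
  C⁻¹ *ᵥ R

/-- A run of an MDP with perturbed rewards, for an arbitrary (possibly randomised and
history-dependent) choice of the actions: `X t`, `U t` are the state and the action at time `t`,
`I t` is the level of the true reward of the step from `t` to `t + 1`, and `J t` is the observed
level.  Given the past `ℱ t`, which contains the present state and action, the next state and
the true reward follow the MDP, and the observed level is `j` with probability `C i j` when the
true level is `i`. -/
structure IsPerturbedRun {S A : Type*} [Fintype S] {M : ℕ} (m : FiniteMDP S A M)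
    (C : Matrix (Fin M) (Fin M) ℝ) {Ω : Type*} {mΩ : MeasurableSpace Ω} (μ : Measure Ω)
    (ℱ : Filtration ℕ mΩ) (X : ℕ → Ω → S) (U : ℕ → Ω → A) (I J : ℕ → Ω → Fin M) : Prop where
  state_meas : ∀ t, Measurable[ℱ t, ⊤] (X t)
  action_meas : ∀ t, Measurable[ℱ t, ⊤] (U t)
  true_meas : ∀ t, Measurable[ℱ (t + 1), ⊤] (I t)
  observed_meas : ∀ t, Measurable[ℱ (t + 1), ⊤] (J t)
  law : ∀ (t : ℕ) (s' : S) (i j : Fin M),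
    μ[Set.indicator {ω | X (t + 1) ω = s' ∧ I t ω = i ∧ J t ω = j} (fun _ => (1 : ℝ)) | ℱ t]
      =ᵐ[μ] fun ω => m.P (X t ω) (U t ω) s' * m.rewardProb (X t ω) (U t ω) s' i * C i j

section QLearning

variable {S A : Type*} [DecidableEq S] [Fintype A] [Nonempty A] [DecidableEq A]

/-- One step of Q-learning with step size `α`, after the transition from `s` to `s'` under `a`
with reward signal `r`: only the entry `(s, a)` changes. -/
noncomputable def qUpdate (γ α r : ℝ) (s : S) (a : A) (s' : S) (q : S → A → ℝ) : S → A → ℝ :=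
  fun x b =>
    if x = s ∧ b = a then
      (1 - α) * q s a + α * (r + γ * Finset.univ.sup' Finset.univ_nonempty (fun c => q s' c))
    else q x b

/-- The Q-learning iterates along a run `X`, `U`, when observing level `k` at a step is given
the reward signal `rhat k`. -/
noncomputable def qLearning {M : ℕ} {Ω : Type*} (γ : ℝ) (rhat : Fin M → ℝ)
    (X : ℕ → Ω → S) (U : ℕ → Ω → A) (J : ℕ → Ω → Fin M) (α : ℕ → Ω → ℝ)
    (Q₀ : Ω → S → A → ℝ) : ℕ → Ω → S → A → ℝ
  | 0, ω => Q₀ ω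
  | t + 1, ω =>
      qUpdate γ (α t ω) (rhat (J t ω)) (X t ω) (U t ω) (X (t + 1) ω)
        (qLearning γ rhat X U J α Q₀ t ω)

end QLearning

end PerturbedQ

/-! Since `C` maps the surrogate rewards back to `R`, the target `r̂ + γ max Q_t(s', ·)` has, given
`ℱ t`, exactly the mean `T Q_t (s_t, a_t)`, where `T` is the Bellman optimality operator of the
unperturbed MDP. Q-learning is therefore asynchronous stochastic approximation `Q ← Q + a (T Q - Q +
w)` with a sup-norm `γ`-contraction `T` and martingale-difference noise `w`.

Noise: `w` is a finite sum, over outcomes (next state, true level, observed level), of an `ℱ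
t`-measurable signal times a bounded centred indicator. Once the steps are at most `1` the iterates
stay bounded, so the weights are almost surely square summable and `ae_tendsto_weighted_sum` makes
the noise series converge.

Dynamics: what remains is pathwise. Shifting the iterates by the tail of the noise series leaves a
contraction with vanishing error, and divergent step sums force convergence to the fixed point
(`tendsto_of_asynchronous_approximation`).

Identification: this fixed point dominates every `Q^π` and is attained by its greedy policy, so it
is `Q*` (`optimalQ_eq_of_bellman_fixedPoint`). -/

/-! ### Deterministic asynchronous relaxation -/

/-- A relaxation towards a level `c` with divergent total step size eventually
drops below every level above `c`. -/
theorem eventually_le_of_relaxation {x a : ℕ → ℝ} {c c' : ℝ} (hc : c < c') (T : ℕ)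
    (ha1 : ∀ t, T ≤ t → a t ≤ 1)
    (hsum : Tendsto (fun n => ∑ t ∈ Finset.range n, a t) atTop atTop)
    (hx : ∀ t, T ≤ t → x (t + 1) ≤ (1 - a t) * x t + a t * c) :
    ∀ᶠ t in atTop, x t ≤ c' := by
  set K := max (x T - c) 0 with hK
  have hK0 : 0 ≤ K := le_max_right _ _
  set σ : ℕ → ℝ := fun n => ∑ t ∈ Finset.range n, a t with hσ
  -- The factors `1 - a t` are bounded by `exp (-a t)`, so the excess over `c` decays with the total
  -- step size. Taking the positive part in `K` keeps the right side nonnegative, as this comparison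
  -- needs.
  have key : ∀ n, T ≤ n → x n - c ≤ K * Real.exp (-(σ n - σ T)) := by
    intro n hn
    induction n, hn using Nat.le_induction with
    | base => simp [hK]
    | succ n hn ih =>
      have h1 : x (n + 1) - c ≤ (1 - a n) * (x n - c) := by
        have := hx n hn
        linarith
      have h2 : (1 - a n) * (x n - c) ≤ (1 - a n) * (K * Real.exp (-(σ n - σ T))) :=
        mul_le_mul_of_nonneg_left ih (by linarith [ha1 n hn])
      have h3 : (1 - a n) * (K * Real.exp (-(σ n - σ T)))
          ≤ Real.exp (-a n) * (K * Real.exp (-(σ n - σ T))) :=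
        mul_le_mul_of_nonneg_right (Real.one_sub_le_exp_neg _) (by positivity)
      have h4 : Real.exp (-a n) * (K * Real.exp (-(σ n - σ T)))
          = K * Real.exp (-(σ (n + 1) - σ T)) := by
        have : -(σ (n + 1) - σ T) = -a n + -(σ n - σ T) := by
          simp only [hσ, Finset.sum_range_succ]; ring
        rw [this, Real.exp_add]; ring
      linarith
  have hlim : Tendsto (fun n => K * Real.exp (-(σ n - σ T))) atTop (𝓝 (K * 0)) :=
    (Real.tendsto_exp_neg_atTop_nhds_zero.comp
      (tendsto_atTop_add_const_right _ (-σ T) hsum)).const_mul K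
  rw [mul_zero] at hlim
  filter_upwards [hlim.eventually (gt_mem_nhds (sub_pos.2 hc)), eventually_ge_atTop T]
    with n h1 h2
  linarith [key n h2]

/-- Asynchronous relaxation of finitely many components, each towards `γ` times the sup norm up
to a vanishing error, converges to zero. -/
theorem tendsto_zero_of_asynchronous_contraction {ι : Type*} [Fintype ι]
    {e a : ℕ → ι → ℝ} {ε : ℕ → ℝ} {γ : ℝ} (hγ0 : 0 ≤ γ) (hγ1 : γ < 1)
    (ha0 : ∀ t i, 0 ≤ a t i) (ha1 : ∀ᶠ t in atTop, ∀ i, a t i ≤ 1)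
    (hsum : ∀ i, Tendsto (fun n => ∑ t ∈ Finset.range n, a t i) atTop atTop)
    (hε : Tendsto ε atTop (𝓝 0)) {B : ℝ} (hB : ∀ᶠ t in atTop, ‖e t‖ ≤ B)
    (step : ∀ᶠ t in atTop, ∀ i,
      |e (t + 1) i| ≤ (1 - a t i) * |e t i| + a t i * (γ * ‖e t‖ + ε t)) :
    Tendsto e atTop (𝓝 0) := by
  have hB0 : 0 ≤ B := by
    obtain ⟨t, ht⟩ := hB.exists
    exact (norm_nonneg _).trans ht
  set ρ := (1 + γ) / 2 with hρ
  have hρ0 : 0 < ρ := by rw [hρ]; linarith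
  have hρ1 : ρ < 1 := by rw [hρ]; linarith
  -- Bootstrapping with a fixed slack `η`: once the norm is below `ρ ^ k * B + η`, every component
  -- relaxes towards a level strictly below `ρ ^ (k + 1) * B + η`.
  have main : ∀ η > 0, ∀ k : ℕ, ∀ᶠ t in atTop, ‖e t‖ ≤ ρ ^ k * B + η := by
    intro η hη k
    induction k with
    | zero =>
      filter_upwards [hB] with t ht
      rw [pow_zero, one_mul]; linarith
    | succ k ih =>
      -- This error budget is what makes `γ * η` plus the error equal `ρ * η`, which is less than
      -- `η`.
      have hη' : 0 < η * (1 - γ) / 2 := by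
        have : 0 < 1 - γ := by linarith
        positivity
      have hev := (((ha1.and step).and ih).and (hε.eventually (gt_mem_nhds hη')))
      obtain ⟨T, hT⟩ := eventually_atTop.1 hev
      have hD : 0 ≤ ρ ^ k * B := by positivity
      have hlt : γ * (ρ ^ k * B + η) + η * (1 - γ) / 2 < ρ ^ (k + 1) * B + η := by
        have h1 : γ * (ρ ^ k * B) ≤ ρ * (ρ ^ k * B) :=
          mul_le_mul_of_nonneg_right (by rw [hρ]; linarith) hD
        have h2 : γ * η + η * (1 - γ) / 2 = ρ * η := by rw [hρ]; ring
        have h3 : ρ * η < 1 * η := mul_lt_mul_of_pos_right hρ1 hη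
        rw [pow_succ]
        linarith
      have hi : ∀ i, ∀ᶠ t in atTop, |e t i| ≤ ρ ^ (k + 1) * B + η := by
        intro i
        refine eventually_le_of_relaxation (x := fun t => |e t i|) hlt T
          (fun t ht => (hT t ht).1.1.1 i) (hsum i) ?_
        intro t ht
        obtain ⟨⟨⟨_, h2⟩, h3⟩, h4⟩ := hT t ht
        refine (h2 i).trans ?_
        have : γ * ‖e t‖ ≤ γ * (ρ ^ k * B + η) := mul_le_mul_of_nonneg_left h3 hγ0
        have := mul_le_mul_of_nonneg_left
          (show γ * ‖e t‖ + ε t ≤ γ * (ρ ^ k * B + η) + η * (1 - γ) / 2 by linarith) (ha0 t i)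
        linarith
      filter_upwards [eventually_all.2 hi] with t ht
      exact (pi_norm_le_iff_of_nonneg (by positivity)).2 fun i => by simpa using ht i
  rw [tendsto_zero_iff_norm_tendsto_zero, Metric.tendsto_atTop]
  intro η hη
  have hpow : Tendsto (fun k : ℕ => ρ ^ k * B) atTop (𝓝 (0 * B)) :=
    (tendsto_pow_atTop_nhds_zero_of_lt_one hρ0.le hρ1).mul_const B
  rw [zero_mul] at hpow
  obtain ⟨k, hk⟩ := (hpow.eventually (gt_mem_nhds (half_pos hη))).exists
  obtain ⟨N, hN⟩ := eventually_atTop.1 (main (η / 4) (by linarith) k)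
  refine ⟨N, fun n hn => ?_⟩
  have := hN n hn
  rw [Real.dist_eq, sub_zero, abs_norm]
  linarith

/-- Asynchronous stochastic approximation, pathwise: bounded iterates driven by a sup-norm
contraction converge to its fixed point as soon as the weighted noise sums converge. -/
theorem tendsto_of_asynchronous_approximation {ι : Type*} [Fintype ι]
    {T : (ι → ℝ) → ι → ℝ} {q : ι → ℝ} {Q a w : ℕ → ι → ℝ} {γ : ℝ} (hγ0 : 0 ≤ γ) (hγ1 : γ < 1)
    (hT : ∀ x y, ‖T x - T y‖ ≤ γ * ‖x - y‖) (hq : T q = q)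
    (ha0 : ∀ t i, 0 ≤ a t i) (ha1 : ∀ᶠ t in atTop, ∀ i, a t i ≤ 1)
    (hsum : ∀ i, Tendsto (fun n => ∑ t ∈ Finset.range n, a t i) atTop atTop)
    {B : ℝ} (hB : ∀ᶠ t in atTop, ‖Q t‖ ≤ B)
    (hw : ∀ i, ∃ l, Tendsto (fun n => ∑ t ∈ Finset.range n, a t i * w t i) atTop (𝓝 l))
    (step : ∀ t i, Q (t + 1) i = Q t i + a t i * (T (Q t) i - Q t i + w t i)) :
    Tendsto Q atTop (𝓝 q) := by
  choose l hl using hw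
  set d : ℕ → ι → ℝ := fun t i => l i - ∑ j ∈ Finset.range t, a j i * w j i with hd
  have hd0 : Tendsto d atTop (𝓝 0) := by
    rw [tendsto_pi_nhds]
    intro i
    have := (hl i).const_sub (l i)
    rw [sub_self] at this
    exact this
  -- As `d` is the tail of the noise series, `d (t + 1) - d t = -a t * w t`, and the noise cancels
  -- in the recursion for `e`. The price is an error `(1 + γ) * ‖d t‖`: `γ` from replacing `Q` by
  -- `e` inside `T`, `1` from relaxing the shift itself.
  set e : ℕ → ι → ℝ := fun t => Q t + d t - q with he
  have hdn : Tendsto (fun t => ‖d t‖) atTop (𝓝 0) := by simpa using hd0.norm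
  have hbd : ∀ᶠ t in atTop, ‖e t‖ ≤ B + 1 + ‖q‖ := by
    filter_upwards [hB, hdn.eventually (gt_mem_nhds one_pos)] with t h1 h2
    calc ‖e t‖ ≤ ‖Q t + d t‖ + ‖q‖ := norm_sub_le _ _
      _ ≤ ‖Q t‖ + ‖d t‖ + ‖q‖ := by gcongr; exact norm_add_le _ _
      _ ≤ _ := by linarith
  have hε : Tendsto (fun t => (1 + γ) * ‖d t‖) atTop (𝓝 0) := by
    simpa using hdn.const_mul (1 + γ)
  have he0 : Tendsto e atTop (𝓝 0) := by
    refine tendsto_zero_of_asynchronous_contraction hγ0 hγ1 ha0 ha1 hsum hε hbd ?_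
    filter_upwards [ha1] with t ht i
    have hstep : e (t + 1) i = (1 - a t i) * e t i + a t i * (T (Q t) i - T q i + d t i) := by
      simp only [he, hd, Pi.add_apply, Pi.sub_apply, step t i, Finset.sum_range_succ, hq]
      ring
    have h1 : |T (Q t) i - T q i| ≤ γ * (‖e t‖ + ‖d t‖) := by
      calc |T (Q t) i - T q i| = ‖(T (Q t) - T q) i‖ := by simp
        _ ≤ ‖T (Q t) - T q‖ := norm_le_pi_norm _ i
        _ ≤ γ * ‖Q t - q‖ := hT _ _
        _ ≤ γ * (‖e t‖ + ‖d t‖) := by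
          refine mul_le_mul_of_nonneg_left ?_ hγ0
          have : Q t - q = e t - d t := by simp only [he]; abel
          rw [this]; exact norm_sub_le _ _
    have h2 : |d t i| ≤ ‖d t‖ := by simpa using norm_le_pi_norm (d t) i
    have h3 : |T (Q t) i - T q i + d t i| ≤ γ * ‖e t‖ + (1 + γ) * ‖d t‖ := by
      refine (abs_add_le _ _).trans ?_
      linarith
    rw [hstep]
    refine (abs_add_le _ _).trans ?_
    rw [abs_mul, abs_mul, abs_of_nonneg (ha0 t i), abs_of_nonneg (sub_nonneg.2 (ht i))]
    have := mul_le_mul_of_nonneg_left h3 (ha0 t i)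
    linarith
  have : Q = fun t => e t - d t + q := by
    funext t; simp only [he]; abel
  rw [this]
  simpa using (he0.sub hd0).add_const q

/-! ### Convergence of martingale transforms -/

section Martingale

variable {Ω : Type*} {mΩ : MeasurableSpace Ω} {μ : Measure Ω} [IsProbabilityMeasure μ]
  {ℱ : Filtration ℕ mΩ} {β D : ℕ → Ω → ℝ}

theorem measurable_weighted_sum (hβ : ∀ t, Measurable[ℱ t] (β t))
    (hD : ∀ t, Measurable[ℱ (t + 1)] (D t)) (n : ℕ) :
    Measurable[ℱ n] (fun ω => ∑ t ∈ Finset.range n, β t ω * D t ω) := by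
  refine Finset.measurable_sum _ fun t ht => ?_
  have h : t + 1 ≤ n := Finset.mem_range.1 ht
  exact ((hβ t).mono (ℱ.mono (by omega)) le_rfl).mul ((hD t).mono (ℱ.mono h) le_rfl)

/-- Martingale transform of bounded martingale differences with weights whose squares have a
uniformly bounded sum. -/
theorem ae_tendsto_weighted_sum_of_bounded (hβ : ∀ t, Measurable[ℱ t] (β t))
    (hD : ∀ t, Measurable[ℱ (t + 1)] (D t)) (hD1 : ∀ t ω, |D t ω| ≤ 1)
    (hD0 : ∀ t, μ[D t | ℱ t] =ᵐ[μ] 0) {K : ℝ}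
    (hK : ∀ n ω, ∑ t ∈ Finset.range n, β t ω ^ 2 ≤ K) :
    ∀ᵐ ω ∂μ, ∃ l, Tendsto (fun n => ∑ t ∈ Finset.range n, β t ω * D t ω) atTop (𝓝 l) := by
  set N : ℕ → Ω → ℝ := fun n ω => ∑ t ∈ Finset.range n, β t ω * D t ω with hN
  have hNm : ∀ n, Measurable[ℱ n] (N n) := measurable_weighted_sum hβ hD
  have hβK : ∀ t ω, |β t ω| ≤ √K := fun t ω => Real.abs_le_sqrt <|
    (Finset.single_le_sum (f := fun t => β t ω ^ 2) (fun _ _ => sq_nonneg _)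
      (Finset.self_mem_range_succ t)).trans (hK (t + 1) ω)
  have hterm : ∀ t ω, |β t ω * D t ω| ≤ √K := fun t ω => by
    rw [abs_mul]
    calc |β t ω| * |D t ω| ≤ √K * 1 :=
          mul_le_mul (hβK t ω) (hD1 t ω) (abs_nonneg _) (Real.sqrt_nonneg _)
      _ = √K := mul_one _
  have hNb : ∀ n ω, |N n ω| ≤ n * √K := fun n ω =>
    (Finset.abs_sum_le_sum_abs _ _).trans <|
      (Finset.sum_le_sum fun t _ => hterm t ω).trans (by simp)
  have bdd_int : ∀ {f : Ω → ℝ} (C : ℝ), Measurable f → (∀ ω, |f ω| ≤ C) → Integrable f μ :=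
    fun C hf hC => Integrable.of_bound hf.aestronglyMeasurable C (Eventually.of_forall hC)
  have hβ' : ∀ t, Measurable (β t) := fun t => (hβ t).mono (ℱ.le t) le_rfl
  have hD' : ∀ t, Measurable (D t) := fun t => (hD t).mono (ℱ.le _) le_rfl
  have hN' : ∀ n, Measurable (N n) := fun n => (hNm n).mono (ℱ.le n) le_rfl
  have hDint : ∀ t, Integrable (D t) μ := fun t => bdd_int 1 (hD' t) (hD1 t)
  have hNint : ∀ n, Integrable (N n) μ := fun n => bdd_int _ (hN' n) (hNb n)
  have hzero : ∀ t (f : Ω → ℝ) (C : ℝ), Measurable[ℱ t] f → (∀ ω, |f ω| ≤ C) →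
      μ[f * D t | ℱ t] =ᵐ[μ] 0 := by
    intro t f C hf hC
    have h := condExp_stronglyMeasurable_mul_of_bound (ℱ.le t) hf.stronglyMeasurable (hDint t) C
      (Eventually.of_forall hC)
    filter_upwards [h, hD0 t] with ω h1 h2
    rw [h1, Pi.mul_apply, h2]; simp
  have hmart : Martingale N ℱ μ := by
    refine martingale_of_condExp_sub_eq_zero_nat (fun n => (hNm n).stronglyMeasurable) hNint ?_
    intro n
    have : N (n + 1) - N n = β n * D n := by
      funext ω; simp [hN, Finset.sum_range_succ]
    rw [this]
    exact hzero n _ _ (hβ n) (hβK n)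
  have hsq_int : ∀ n, Integrable (fun ω => N n ω ^ 2) μ := fun n =>
    bdd_int ((n * √K) ^ 2) ((hN' n).pow_const 2) fun ω => by
      rw [abs_pow]; exact pow_le_pow_left₀ (abs_nonneg _) (hNb n ω) 2
  have hβsq_int : ∀ t, Integrable (fun ω => β t ω ^ 2) μ := fun t =>
    bdd_int (√K ^ 2) ((hβ' t).pow_const 2) fun ω => by
      rw [abs_pow]; exact pow_le_pow_left₀ (abs_nonneg _) (hβK t ω) 2
  -- Orthogonality of increments: the cross term has mean zero, and `D n ^ 2 ≤ 1` bounds the square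
  -- of the increment.
  have hL2 : ∀ n, ∫ ω, N n ω ^ 2 ∂μ ≤ ∑ t ∈ Finset.range n, ∫ ω, β t ω ^ 2 ∂μ := by
    intro n
    induction n with
    | zero => simp [hN]
    | succ n ih =>
      set f : Ω → ℝ := fun ω => 2 * N n ω * β n ω with hf
      have hfm : Measurable[ℱ n] f := ((hNm n).const_mul 2).mul (hβ n)
      have hfb : ∀ ω, |f ω| ≤ 2 * (n * √K) * √K := fun ω => by
        simp only [hf, abs_mul, abs_two]
        exact mul_le_mul (mul_le_mul_of_nonneg_left (hNb n ω) zero_le_two) (hβK n ω)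
          (abs_nonneg _) (by positivity)
      have hfint : Integrable (f * D n) μ :=
        bdd_int (2 * (n * √K) * √K * 1) ((hfm.mono (ℱ.le n) le_rfl).mul (hD' n)) fun ω => by
          rw [Pi.mul_apply, abs_mul]
          exact mul_le_mul (hfb ω) (hD1 n ω) (abs_nonneg _) (by positivity)
      have hcross : ∫ ω, (f * D n) ω ∂μ = 0 := by
        rw [← integral_condExp (ℱ.le n), integral_congr_ae (hzero n f _ hfm hfb)]
        simp
      calc ∫ ω, N (n + 1) ω ^ 2 ∂μ
          ≤ ∫ ω, (N n ω ^ 2 + (f * D n) ω + β n ω ^ 2) ∂μ := by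
            refine integral_mono (hsq_int _) (((hsq_int n).add hfint).add (hβsq_int n)) fun ω => ?_
            have h1 : N (n + 1) ω = N n ω + β n ω * D n ω := by
              simp [hN, Finset.sum_range_succ]
            have h2 : D n ω ^ 2 ≤ 1 := by
              rw [← sq_abs]; exact pow_le_one₀ (abs_nonneg _) (hD1 n ω)
            have h3 := mul_le_mul_of_nonneg_left h2 (sq_nonneg (β n ω))
            simp only [h1, hf, Pi.mul_apply]
            nlinarith
        _ = ∫ ω, N n ω ^ 2 ∂μ + ∫ ω, β n ω ^ 2 ∂μ := by
            have h1 := integral_add ((hsq_int n).add hfint) (hβsq_int n)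
            have h2 := integral_add (hsq_int n) hfint
            simp only [Pi.add_apply] at h1 h2
            rw [h1, h2, hcross, add_zero]
        _ ≤ _ := by rw [Finset.sum_range_succ]; linarith
  have hL2K : ∀ n, ∫ ω, N n ω ^ 2 ∂μ ≤ K := by
    intro n
    refine (hL2 n).trans ?_
    rw [← integral_finsetSum _ fun t _ => hβsq_int t]
    calc ∫ ω, ∑ t ∈ Finset.range n, β t ω ^ 2 ∂μ ≤ ∫ _, K ∂μ :=
          integral_mono (integrable_finsetSum _ fun t _ => hβsq_int t) (integrable_const _)
            (hK n)
      _ = K := by simp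
  -- Doob's theorem needs only an `L¹` bound, which follows from `|x| ≤ 1 + x ^ 2`.
  refine hmart.submartingale.exists_ae_tendsto_of_bdd (R := (1 + K).toNNReal) fun n => ?_
  rw [eLpNorm_one_eq_lintegral_enorm, ← ofReal_integral_norm_eq_lintegral_enorm (hNint n)]
  refine ENNReal.ofReal_le_ofReal ?_
  calc ∫ ω, ‖N n ω‖ ∂μ ≤ ∫ ω, (1 + N n ω ^ 2) ∂μ := by
        refine integral_mono (hNint n).norm ((integrable_const _).add (hsq_int n)) fun ω => ?_
        simp only [Real.norm_eq_abs]
        nlinarith [sq_abs (N n ω), sq_nonneg (|N n ω| - 1), abs_nonneg (N n ω)]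
    _ ≤ 1 + K := by
        rw [integral_add (integrable_const _) (hsq_int n)]
        simpa using hL2K n

/-- Martingale transform of bounded martingale differences with almost surely square summable
predictable weights. -/
theorem ae_tendsto_weighted_sum (hβ : ∀ t, Measurable[ℱ t] (β t))
    (hD : ∀ t, Measurable[ℱ (t + 1)] (D t)) (hD1 : ∀ t ω, |D t ω| ≤ 1)
    (hD0 : ∀ t, μ[D t | ℱ t] =ᵐ[μ] 0) (hsum : ∀ᵐ ω ∂μ, Summable fun t => β t ω ^ 2) :
    ∀ᵐ ω ∂μ, ∃ l, Tendsto (fun n => ∑ t ∈ Finset.range n, β t ω * D t ω) atTop (𝓝 l) := by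
  classical
  -- Truncation by stopping: a weight is dropped once the sum of squares, its own included, exceeds
  -- `K`. Including the present term keeps the total below `K` without overshoot, and `b K t` is
  -- still `ℱ t`-measurable. On a path with total at most `K` nothing is dropped.
  set b : ℕ → ℕ → Ω → ℝ := fun K t ω =>
    if ∑ i ∈ Finset.range (t + 1), β i ω ^ 2 ≤ K then β t ω else 0 with hb
  have hbm : ∀ K t, Measurable[ℱ t] (b K t) := by
    intro K t
    have hs : Measurable[ℱ t] fun ω => ∑ i ∈ Finset.range (t + 1), β i ω ^ 2 :=
      Finset.measurable_sum _ fun i hi =>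
        ((hβ i).mono (ℱ.mono (Nat.lt_succ_iff.1 (Finset.mem_range.1 hi))) le_rfl).pow_const 2
    exact Measurable.ite (hs measurableSet_Iic) (hβ t) measurable_const
  have hbK : ∀ (K n : ℕ) ω, ∑ t ∈ Finset.range n, b K t ω ^ 2 ≤ K := by
    intro K n ω
    induction n with
    | zero => simp
    | succ n ih =>
      by_cases h : ∑ i ∈ Finset.range (n + 1), β i ω ^ 2 ≤ K
      · refine (Finset.sum_le_sum fun t _ => ?_).trans h
        simp only [hb]
        split_ifs
        · exact le_rfl
        · simpa using sq_nonneg (β t ω)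
      · rw [Finset.sum_range_succ]
        simpa [hb, h] using ih
  have hall := ae_all_iff.2 fun K : ℕ =>
    ae_tendsto_weighted_sum_of_bounded (hbm K) hD hD1 hD0 (hbK K)
  filter_upwards [hall, hsum] with ω h1 h2
  obtain ⟨K, hK⟩ := exists_nat_ge (∑' t, β t ω ^ 2)
  obtain ⟨l, hl⟩ := h1 K
  refine ⟨l, hl.congr fun n => Finset.sum_congr rfl fun t _ => ?_⟩
  have : ∑ i ∈ Finset.range (t + 1), β i ω ^ 2 ≤ K :=
    (h2.sum_le_tsum _ fun _ _ => sq_nonneg _).trans hK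
  simp [hb, this]

end Martingale

/-! ### Bellman equations and the optimal action-value function -/

namespace PerturbedQ

theorem abs_sup'_sub_sup'_le {A : Type*} [Fintype A] [Nonempty A] {f g : A → ℝ} {d : ℝ}
    (h : ∀ a, |f a - g a| ≤ d) :
    |Finset.univ.sup' Finset.univ_nonempty f - Finset.univ.sup' Finset.univ_nonempty g| ≤ d := by
  have one_side : ∀ {f g : A → ℝ}, (∀ a, |f a - g a| ≤ d) →
      Finset.univ.sup' Finset.univ_nonempty f
        ≤ d + Finset.univ.sup' Finset.univ_nonempty g := fun {f g} h =>
    Finset.sup'_le _ _ fun a ha => by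
      linarith [Finset.le_sup' g ha, (abs_le.1 (h a)).2]
  have h1 := one_side h
  have h2 := one_side (f := g) (g := f) fun a => by rw [abs_sub_comm]; exact h a
  exact abs_le.2 ⟨by linarith, by linarith⟩

theorem weighted_sum_le {ι : Type*} [Fintype ι] {p f : ι → ℝ} {d : ℝ} (hp : ∀ i, 0 ≤ p i)
    (hp1 : ∑ i, p i = 1) (hf : ∀ i, f i ≤ d) : ∑ i, p i * f i ≤ d := by
  calc ∑ i, p i * f i ≤ ∑ i, p i * d :=
        Finset.sum_le_sum fun i _ => mul_le_mul_of_nonneg_left (hf i) (hp i)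
    _ = d := by rw [← Finset.sum_mul, hp1, one_mul]

theorem abs_weighted_sum_le {ι : Type*} [Fintype ι] {p f : ι → ℝ} {d : ℝ} (hp : ∀ i, 0 ≤ p i)
    (hp1 : ∑ i, p i = 1) (hf : ∀ i, |f i| ≤ d) : |∑ i, p i * f i| ≤ d := by
  refine (Finset.abs_sum_le_sum_abs _ _).trans ?_
  simp_rw [abs_mul, abs_of_nonneg (hp _)]
  exact weighted_sum_le hp hp1 hf

section

variable {S A : Type*} [Fintype S] [Fintype A] {M : ℕ}

/-- Taking `d` to be the maximum of `f` gives `max f ≤ γ * max f`. This one-sided comparison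
principle replaces iteration of the Bellman operator. -/
theorem nonpos_of_discounted_bound {ι : Type*} [Fintype ι] {γ : ℝ} (hγ : γ < 1) {f : ι → ℝ}
    (h : ∀ d, (∀ i, f i ≤ d) → ∀ i, f i ≤ γ * d) (i : ι) : f i ≤ 0 := by
  obtain ⟨j, -, hj⟩ := Finset.exists_max_image Finset.univ f ⟨i, Finset.mem_univ i⟩
  have h1 := h (f j) (fun k => hj k (Finset.mem_univ k)) j
  have h2 := hj i (Finset.mem_univ i)
  nlinarith

/-- The Bellman optimality operator on action-value functions. -/
noncomputable def FiniteMDP.bellman [Nonempty A] (m : FiniteMDP S A M) (q : S × A → ℝ) :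
    S × A → ℝ := fun z =>
  m.meanReward z.1 z.2 +
    m.γ * ∑ s', m.P z.1 z.2 s' * Finset.univ.sup' Finset.univ_nonempty fun c => q (s', c)

/-- Neither the maximum over actions nor averaging over next states expands sup distances; only the
factor `γ` remains. -/
theorem FiniteMDP.norm_bellman_sub_le [Nonempty A] (m : FiniteMDP S A M) (x y : S × A → ℝ) :
    ‖m.bellman x - m.bellman y‖ ≤ m.γ * ‖x - y‖ := by
  refine (pi_norm_le_iff_of_nonneg (mul_nonneg m.γ_nonneg (norm_nonneg _))).2 fun z => ?_
  have : (m.bellman x - m.bellman y) z = m.γ * ∑ s', m.P z.1 z.2 s' *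
      ((Finset.univ.sup' Finset.univ_nonempty fun c => x (s', c)) -
        Finset.univ.sup' Finset.univ_nonempty fun c => y (s', c)) := by
    simp only [Pi.sub_apply, bellman, mul_sub, Finset.sum_sub_distrib]
    ring
  rw [this, Real.norm_eq_abs, abs_mul, abs_of_nonneg m.γ_nonneg]
  refine mul_le_mul_of_nonneg_left ?_ m.γ_nonneg
  exact abs_weighted_sum_le (m.P_nonneg _ _) (m.P_sum _ _) fun s' =>
    abs_sup'_sub_sup'_le fun c => norm_le_pi_norm (x - y) (s', c)

theorem FiniteMDP.exists_bellman_fixedPoint [Nonempty A] (m : FiniteMDP S A M) (hγ : m.γ < 1) :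
    ∃ q, m.bellman q = q := by
  have hc : ContractingWith (NNReal.mk m.γ m.γ_nonneg) m.bellman :=
    ⟨NNReal.coe_lt_coe.1 hγ, LipschitzWith.of_dist_le_mul fun x y => by
      rw [dist_eq_norm, dist_eq_norm]; exact m.norm_bellman_sub_le x y⟩
  exact ⟨_, hc.fixedPoint_isFixedPt⟩

variable [DecidableEq S]

/-- Conditioning on the first step, that is, splitting off the first factor of the matrix power. -/
theorem FiniteMDP.expectedReward_succ (m : FiniteMDP S A M) (π : Policy S A) (k : ℕ) (s : S) :
    m.expectedReward π (k + 1) s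
      = ∑ a, π.prob s a * ∑ s', m.P s a s' * m.expectedReward π k s' := by
  have h1 : m.expectedReward π (k + 1) s
      = ∑ s', m.policyMatrix π s s' * m.expectedReward π k s' := by
    simp only [expectedReward, pow_succ', Matrix.mul_apply, Finset.sum_mul]
    rw [Finset.sum_comm]
    simp only [mul_assoc, ← Finset.mul_sum]
  rw [h1]
  simp only [policyMatrix, Matrix.of_apply, Finset.sum_mul, Finset.mul_sum]
  rw [Finset.sum_comm]
  simp only [mul_assoc]

theorem FiniteMDP.summable_expectedReward (m : FiniteMDP S A M) (hγ : m.γ < 1)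
    (π : Policy S A) (s : S) : Summable fun k => m.γ ^ k * m.expectedReward π k s := by
  obtain ⟨B, hB⟩ : ∃ B, ∀ z : S × A, |m.meanReward z.1 z.2| ≤ B :=
    ⟨∑ z : S × A, |m.meanReward z.1 z.2|, fun z => Finset.single_le_sum
      (f := fun z : S × A => |m.meanReward z.1 z.2|) (fun _ _ => abs_nonneg _)
      (Finset.mem_univ z)⟩
  have hE : ∀ k s, |m.expectedReward π k s| ≤ B := by
    intro k
    induction k with
    | zero =>
      intro s
      have : m.expectedReward π 0 s = ∑ a, π.prob s a * m.meanReward s a := by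
        simp [expectedReward, Matrix.one_apply]
      rw [this]
      exact abs_weighted_sum_le (π.prob_nonneg s) (π.prob_sum s) fun a => hB (s, a)
    | succ k ih =>
      intro s
      rw [m.expectedReward_succ]
      exact abs_weighted_sum_le (π.prob_nonneg s) (π.prob_sum s) fun a =>
        abs_weighted_sum_le (m.P_nonneg s a) (m.P_sum s a) ih
  refine Summable.of_norm_bounded (g := fun k => m.γ ^ k * B)
    ((summable_geometric_of_lt_one m.γ_nonneg hγ).mul_right B) fun k => ?_
  rw [Real.norm_eq_abs, abs_mul, abs_of_nonneg (pow_nonneg m.γ_nonneg k)]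
  exact mul_le_mul_of_nonneg_left (hE k s) (pow_nonneg m.γ_nonneg k)

/-- The term `k = 0` gives the mean reward; the remaining series is rewritten by first-step
conditioning. -/
theorem FiniteMDP.V_eq (m : FiniteMDP S A M) (hγ : m.γ < 1) (π : Policy S A) (s : S) :
    m.V π s = ∑ a, π.prob s a * m.Q π s a := by
  have h0 : m.expectedReward π 0 s = ∑ a, π.prob s a * m.meanReward s a := by
    simp [expectedReward, Matrix.one_apply]
  have hsum := fun s' => (m.summable_expectedReward hγ π s').hasSum
  have h1 : HasSum (fun k => m.γ ^ (k + 1) * m.expectedReward π (k + 1) s)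
      (∑ a, π.prob s a * (m.γ * ∑ s', m.P s a s' * m.V π s')) := by
    have := hasSum_sum (s := Finset.univ) fun a (_ : a ∈ Finset.univ) =>
      ((hasSum_sum (s := Finset.univ) fun s' (_ : s' ∈ Finset.univ) =>
        (hsum s').mul_left (m.P s a s')).mul_left m.γ).mul_left (π.prob s a)
    refine (congrArg (HasSum · _) (funext fun k => ?_)).mpr this
    rw [m.expectedReward_succ, Finset.mul_sum]
    refine Finset.sum_congr rfl fun a _ => ?_
    simp only [Finset.mul_sum]
    refine Finset.sum_congr rfl fun s' _ => ?_
    ring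
  have h2 : m.V π s = m.γ ^ 0 * m.expectedReward π 0 s +
      ∑' k, m.γ ^ (k + 1) * m.expectedReward π (k + 1) s :=
    (m.summable_expectedReward hγ π s).tsum_eq_zero_add
  rw [h2, h1.tsum_eq, pow_zero, one_mul, h0, ← Finset.sum_add_distrib]
  refine Finset.sum_congr rfl fun a _ => ?_
  rw [Q, mul_add]

/-- A fixed point of the Bellman operator is the optimal action-value function. -/
theorem FiniteMDP.optimalQ_eq_of_bellman_fixedPoint [Nonempty A] (m : FiniteMDP S A M)
    (hγ : m.γ < 1) {q : S × A → ℝ} (hq : m.bellman q = q) (s : S) (a : A) :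
    m.optimalQ s a = q (s, a) := by
  classical
  have hqz : ∀ z : S × A, q z = m.meanReward z.1 z.2 + m.γ * ∑ s', m.P z.1 z.2 s' *
      Finset.univ.sup' Finset.univ_nonempty fun c => q (s', c) := fun z => (congrFun hq z).symm
  -- The excess of `Q^π` over `q` is `γ` times an average of itself at most, because `V^π` averages
  -- `Q^π` while `q` enters through its maximum.
  have upper : ∀ (π : Policy S A) (z : S × A), m.Q π z.1 z.2 - q z ≤ 0 := by
    intro π
    refine nonpos_of_discounted_bound hγ fun d hd z => ?_
    have hz : m.Q π z.1 z.2 - q z = m.γ * ∑ s', m.P z.1 z.2 s' * (m.V π s' -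
        Finset.univ.sup' Finset.univ_nonempty fun c => q (s', c)) := by
      rw [hqz z, Q]
      simp only [mul_sub, Finset.sum_sub_distrib]
      ring
    rw [hz]
    refine mul_le_mul_of_nonneg_left (weighted_sum_le (m.P_nonneg _ _) (m.P_sum _ _)
      fun s' => ?_) m.γ_nonneg
    rw [m.V_eq hγ, sub_le_iff_le_add]
    refine weighted_sum_le (π.prob_nonneg s') (π.prob_sum s') fun c => ?_
    have h1 := Finset.le_sup' (fun c => q (s', c)) (Finset.mem_univ c)
    have h2 := hd (s', c)
    simp only at h1 h2
    linarith
  have hg : ∀ s', ∃ c, Finset.univ.sup' Finset.univ_nonempty (fun c => q (s', c)) = q (s', c) :=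
    fun s' => by
      obtain ⟨c, -, hc⟩ := Finset.exists_mem_eq_sup' Finset.univ_nonempty fun c => q (s', c)
      exact ⟨c, hc⟩
  choose g hg using hg
  -- The greedy policy for `q` turns the maximum into a value, so the deficit obeys the same kind of
  -- bound.
  let π₀ : Policy S A :=
    { prob := fun s a => if a = g s then 1 else 0
      prob_nonneg := fun s a => by split_ifs <;> norm_num
      prob_sum := fun s => by simp }
  have hV : ∀ s', m.V π₀ s' = m.Q π₀ s' (g s') := fun s' => by
    rw [m.V_eq hγ]; simp [π₀]
  have lower : ∀ z : S × A, q z - m.Q π₀ z.1 z.2 ≤ 0 := by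
    refine nonpos_of_discounted_bound hγ fun d hd z => ?_
    have hz : q z - m.Q π₀ z.1 z.2 = m.γ * ∑ s', m.P z.1 z.2 s' *
        (q (s', g s') - m.Q π₀ s' (g s')) := by
      rw [hqz z, Q]
      simp only [mul_sub, Finset.sum_sub_distrib, hg, hV]
      ring
    rw [hz]
    exact mul_le_mul_of_nonneg_left (weighted_sum_le (m.P_nonneg _ _) (m.P_sum _ _)
      fun s' => hd (s', g s')) m.γ_nonneg
  have hle : ∀ π : Policy S A, m.Q π s a ≤ q (s, a) := fun π => by
    have := upper π (s, a)
    simp only at this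
    linarith
  have : Nonempty (Policy S A) := ⟨π₀⟩
  refine le_antisymm (ciSup_le hle) ?_
  have h1 : m.Q π₀ s a ≤ m.optimalQ s a :=
    le_ciSup (f := fun π : Policy S A => m.Q π s a) ⟨_, Set.forall_mem_range.2 hle⟩ π₀
  have h2 := lower (s, a)
  simp only at h2
  linarith

end

end PerturbedQ

/-! ### Measurability and boundedness of the iterates -/

theorem Measurable.comp_fintype_index {S Ω : Type*} [Fintype S] [mΩ : MeasurableSpace Ω]
    {Y : Ω → S} {f : S → Ω → ℝ} (hY : Measurable[mΩ, ⊤] Y) (hf : ∀ s, Measurable (f s)) :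
    Measurable fun ω => f (Y ω) ω := by
  classical
  have : (fun ω => f (Y ω) ω) = fun ω => ∑ s, if Y ω = s then f s ω else 0 := by
    funext ω; simp
  rw [this]
  exact Finset.measurable_sum _ fun s _ =>
    Measurable.ite (hY (t := {s}) trivial) (hf s) measurable_const

theorem measurable_sup'_univ {A Ω : Type*} [Fintype A] [Nonempty A] [MeasurableSpace Ω]
    {f : A → Ω → ℝ} (hf : ∀ a, Measurable (f a)) :
    Measurable fun ω => Finset.univ.sup' Finset.univ_nonempty fun a => f a ω := by
  convert Finset.measurable_sup' (Finset.univ_nonempty (α := A)) fun a _ => hf a using 2 with ω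
  simp

namespace PerturbedQ

section

variable {S A : Type*} [DecidableEq S] [Fintype A] [Nonempty A] [DecidableEq A]

theorem measurable_qUpdate [Fintype S] {M : ℕ} {Ω : Type*} [mΩ : MeasurableSpace Ω] {γ : ℝ}
    {rhat : Fin M → ℝ} {α : Ω → ℝ} {J : Ω → Fin M} {x x' : Ω → S} {u : Ω → A}
    {q : Ω → S → A → ℝ} (hα : Measurable α) (hJ : Measurable[mΩ, ⊤] J)
    (hx : Measurable[mΩ, ⊤] x) (hx' : Measurable[mΩ, ⊤] x') (hu : Measurable[mΩ, ⊤] u)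
    (hq : ∀ s a, Measurable fun ω => q ω s a) (s : S) (a : A) :
    Measurable fun ω => qUpdate γ (α ω) (rhat (J ω)) (x ω) (u ω) (x' ω) (q ω) s a := by
  have hmax : ∀ s', Measurable fun ω =>
      Finset.univ.sup' Finset.univ_nonempty fun c => q ω s' c := fun s' =>
    measurable_sup'_univ fun c => hq s' c
  have h1 : Measurable fun ω => q ω (x ω) (u ω) :=
    Measurable.comp_fintype_index hx fun s => Measurable.comp_fintype_index hu fun a => hq s a
  have h2 : Measurable fun ω =>
      Finset.univ.sup' Finset.univ_nonempty fun c => q ω (x' ω) c :=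
    Measurable.comp_fintype_index (f := fun s' ω =>
      Finset.univ.sup' Finset.univ_nonempty fun c => q ω s' c) hx' hmax
  have h3 : Measurable fun ω => rhat (J ω) := measurable_from_top.comp hJ
  have hset : MeasurableSet {ω | s = x ω ∧ a = u ω} := by
    have hs : MeasurableSet {ω | s = x ω} := hx (t := {y | s = y}) trivial
    exact hs.inter (hu (t := {y | a = y}) trivial)
  exact Measurable.ite hset
    (((measurable_const.sub hα).mul h1).add (hα.mul (h3.add (h2.const_mul γ)))) (hq s a)

/-- The new entry is a convex combination of the old one and a target of size at most `ρ + γ * K`,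
so the box of radius `K` is invariant. -/
theorem abs_qUpdate_le {γ α r ρ K : ℝ} {s s' : S} {a : A} {q : S → A → ℝ} (hγ : 0 ≤ γ)
    (hα0 : 0 ≤ α) (hα1 : α ≤ 1) (hr : |r| ≤ ρ) (hK : ρ + γ * K ≤ K)
    (hq : ∀ x b, |q x b| ≤ K) (x : S) (b : A) : |qUpdate γ α r s a s' q x b| ≤ K := by
  unfold qUpdate
  split_ifs
  · obtain ⟨c, -, hc⟩ := Finset.exists_mem_eq_sup' Finset.univ_nonempty fun c => q s' c
    rw [hc]
    have h1 : |r + γ * q s' c| ≤ K := by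
      refine (abs_add_le _ _).trans ?_
      rw [abs_mul, abs_of_nonneg hγ]
      have := mul_le_mul_of_nonneg_left (hq s' c) hγ
      linarith
    refine (abs_add_le _ _).trans ?_
    rw [abs_mul, abs_mul, abs_of_nonneg hα0, abs_of_nonneg (sub_nonneg.2 hα1)]
    have h2 := mul_le_mul_of_nonneg_left h1 hα0
    have h3 := mul_le_mul_of_nonneg_left (hq s a) (sub_nonneg.2 hα1)
    linarith
  · exact hq x b

/-- With step sizes that are eventually in `[0, 1]`, the iterates of Q-learning stay bounded. -/
theorem qLearning_eventually_bounded [Fintype S] {M : ℕ} {Ω : Type*} {γ : ℝ} (hγ0 : 0 ≤ γ)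
    (hγ1 : γ < 1) (rhat : Fin M → ℝ) (X : ℕ → Ω → S) (U : ℕ → Ω → A) (J : ℕ → Ω → Fin M)
    (α : ℕ → Ω → ℝ) (Q₀ : Ω → S → A → ℝ) {ω : Ω} (h0 : ∀ t, 0 ≤ α t ω)
    (h1 : ∀ᶠ t in atTop, α t ω ≤ 1) :
    ∃ K, 0 ≤ K ∧ ∀ᶠ t in atTop, ∀ s a, |qLearning γ rhat X U J α Q₀ t ω s a| ≤ K := by
  obtain ⟨T, hT⟩ := eventually_atTop.1 h1
  set ρ := ∑ k, |rhat k| with hρ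
  have hρk : ∀ k, |rhat k| ≤ ρ := fun k =>
    Finset.single_le_sum (f := fun k => |rhat k|) (fun _ _ => abs_nonneg _) (Finset.mem_univ k)
  have hρ0 : 0 ≤ ρ := Finset.sum_nonneg fun _ _ => abs_nonneg _
  set N := ∑ z : S × A, |qLearning γ rhat X U J α Q₀ T ω z.1 z.2| with hN
  have hN0 : 0 ≤ N := Finset.sum_nonneg fun _ _ => abs_nonneg _
  have hγ : 0 < 1 - γ := by linarith
  -- `ρ / (1 - γ)` solves `ρ + γ * K = K`; adding `N`, which covers the values at time `T`,
  -- preserves the inequality.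
  have hK : ρ + γ * (ρ / (1 - γ) + N) ≤ ρ / (1 - γ) + N := by
    have h2 : ρ / (1 - γ) * (1 - γ) = ρ := div_mul_cancel₀ _ hγ.ne'
    nlinarith
  refine ⟨ρ / (1 - γ) + N, by positivity, eventually_atTop.2 ⟨T, fun t ht => ?_⟩⟩
  induction t, ht using Nat.le_induction with
  | base =>
    intro s a
    have := Finset.single_le_sum
      (f := fun z : S × A => |qLearning γ rhat X U J α Q₀ T ω z.1 z.2|)
      (fun _ _ => abs_nonneg _) (Finset.mem_univ (s, a))
    have : 0 ≤ ρ / (1 - γ) := by positivity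
    simp only at *
    linarith
  | succ t ht ih =>
    intro s a
    exact abs_qUpdate_le hγ0 (h0 t) (hT t ht) (hρk _) hK ih s a

end

/-! ### Transition noise and unbiasedness of the surrogate rewards -/

section

variable {S A : Type*} [Fintype S] {M : ℕ} {m : FiniteMDP S A M} {C : Matrix (Fin M) (Fin M) ℝ}
  {Ω : Type*} {mΩ : MeasurableSpace Ω} {μ : Measure Ω} {ℱ : Filtration ℕ mΩ}
  {X : ℕ → Ω → S} {U : ℕ → Ω → A} {I J : ℕ → Ω → Fin M}

/-- Conditional probability of next state, true level and observed level, given the present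
state and action. -/
def transitionProb (m : FiniteMDP S A M) (C : Matrix (Fin M) (Fin M) ℝ) (s : S) (a : A)
    (e : S × Fin M × Fin M) : ℝ :=
  m.P s a e.1 * m.rewardProb s a e.1 e.2.1 * C e.2.1 e.2.2

/-- Indicator of a transition outcome, centred by its conditional probability. -/
noncomputable def transitionNoise (m : FiniteMDP S A M) (C : Matrix (Fin M) (Fin M) ℝ)
    (X : ℕ → Ω → S) (U : ℕ → Ω → A) (I J : ℕ → Ω → Fin M) (e : S × Fin M × Fin M) (t : ℕ)
    (ω : Ω) : ℝ :=
  Set.indicator {ω | X (t + 1) ω = e.1 ∧ I t ω = e.2.1 ∧ J t ω = e.2.2} (fun _ => (1 : ℝ)) ω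
    - transitionProb m C (X t ω) (U t ω) e

theorem transitionProb_mem_Icc (hC : ∀ j k, 0 ≤ C j k) (hC1 : ∀ j, ∑ k, C j k = 1) (s : S)
    (a : A) (e : S × Fin M × Fin M) : transitionProb m C s a e ∈ Set.Icc (0 : ℝ) 1 := by
  have hP : m.P s a e.1 ≤ 1 := by
    rw [← m.P_sum s a]
    exact Finset.single_le_sum (f := m.P s a) (fun _ _ => m.P_nonneg _ _ _) (Finset.mem_univ _)
  have hr : m.rewardProb s a e.1 e.2.1 ≤ 1 := by
    rw [← m.rewardProb_sum s a e.1]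
    exact Finset.single_le_sum (f := m.rewardProb s a e.1)
      (fun _ _ => m.rewardProb_nonneg _ _ _ _) (Finset.mem_univ _)
  have hc : C e.2.1 e.2.2 ≤ 1 := by
    rw [← hC1 e.2.1]
    exact Finset.single_le_sum (f := C e.2.1) (fun _ _ => hC _ _) (Finset.mem_univ _)
  have hP0 := m.P_nonneg s a e.1
  have hr0 := m.rewardProb_nonneg s a e.1 e.2.1
  exact ⟨mul_nonneg (mul_nonneg hP0 hr0) (hC _ _),
    mul_le_one₀ (mul_le_one₀ hP hr0 hr) (hC _ _) hc⟩

theorem abs_transitionNoise_le (hC : ∀ j k, 0 ≤ C j k) (hC1 : ∀ j, ∑ k, C j k = 1)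
    (e : S × Fin M × Fin M) (t : ℕ) (ω : Ω) : |transitionNoise m C X U I J e t ω| ≤ 1 := by
  obtain ⟨h0, h1⟩ := transitionProb_mem_Icc (m := m) hC hC1 (X t ω) (U t ω) e
  unfold transitionNoise Set.indicator
  split_ifs <;> exact abs_le.2 ⟨by linarith, by linarith⟩

theorem measurable_transitionProb [Fintype A] (hrun : IsPerturbedRun m C μ ℱ X U I J)
    (e : S × Fin M × Fin M) (t : ℕ) :
    Measurable[ℱ t] fun ω => transitionProb m C (X t ω) (U t ω) e :=
  Measurable.comp_fintype_index (mΩ := ℱ t)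
    (f := fun s ω => transitionProb m C s (U t ω) e) (hrun.state_meas t) fun s =>
      Measurable.comp_fintype_index (mΩ := ℱ t) (f := fun a _ => transitionProb m C s a e)
        (hrun.action_meas t) fun _ => measurable_const

theorem measurable_outcome_indicator (hrun : IsPerturbedRun m C μ ℱ X U I J)
    (e : S × Fin M × Fin M) (t : ℕ) :
    Measurable[ℱ (t + 1)]
      (Set.indicator {ω | X (t + 1) ω = e.1 ∧ I t ω = e.2.1 ∧ J t ω = e.2.2}
        (fun _ => (1 : ℝ))) := by
  refine Measurable.indicator measurable_const ?_
  have h1 : MeasurableSet[ℱ (t + 1)] {ω | X (t + 1) ω = e.1} :=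
    (hrun.state_meas (t + 1)) (MeasurableSpace.measurableSet_top (s := {e.1}))
  have h2 : MeasurableSet[ℱ (t + 1)] {ω | I t ω = e.2.1} :=
    (hrun.true_meas t) (MeasurableSpace.measurableSet_top (s := {e.2.1}))
  have h3 : MeasurableSet[ℱ (t + 1)] {ω | J t ω = e.2.2} :=
    (hrun.observed_meas t) (MeasurableSpace.measurableSet_top (s := {e.2.2}))
  exact h1.inter (h2.inter h3)

theorem measurable_transitionNoise [Fintype A] (hrun : IsPerturbedRun m C μ ℱ X U I J)
    (e : S × Fin M × Fin M) (t : ℕ) :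
    Measurable[ℱ (t + 1)] (transitionNoise m C X U I J e t) :=
  (measurable_outcome_indicator hrun e t).sub
    ((measurable_transitionProb hrun e t).mono (ℱ.mono t.le_succ) le_rfl)

theorem condExp_transitionNoise [Fintype A] [IsProbabilityMeasure μ]
    (hC : ∀ j k, 0 ≤ C j k) (hC1 : ∀ j, ∑ k, C j k = 1)
    (hrun : IsPerturbedRun m C μ ℱ X U I J) (e : S × Fin M × Fin M) (t : ℕ) :
    μ[transitionNoise m C X U I J e t | ℱ t] =ᵐ[μ] 0 := by
  have hp := measurable_transitionProb hrun e t
  have hpint : Integrable (fun ω => transitionProb m C (X t ω) (U t ω) e) μ :=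
    Integrable.of_bound (hp.mono (ℱ.le t) le_rfl).aestronglyMeasurable 1
      (Eventually.of_forall fun ω => by
        obtain ⟨h0, h1⟩ := transitionProb_mem_Icc (m := m) hC hC1 (X t ω) (U t ω) e
        rwa [Real.norm_eq_abs, abs_of_nonneg h0])
  have hiint : Integrable (Set.indicator
      {ω | X (t + 1) ω = e.1 ∧ I t ω = e.2.1 ∧ J t ω = e.2.2} (fun _ => (1 : ℝ))) μ :=
    Integrable.of_bound
      ((measurable_outcome_indicator hrun e t).mono (ℱ.le _) le_rfl).aestronglyMeasurable 1
      (Eventually.of_forall fun ω => by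
        unfold Set.indicator
        split_ifs <;> simp)
  have h1 := condExp_sub hiint hpint (ℱ t)
  rw [condExp_of_stronglyMeasurable (ℱ.le t) hp.stronglyMeasurable hpint] at h1
  refine EventuallyEq.trans h1 ?_
  filter_upwards [hrun.law t e.1 e.2.1 e.2.2] with ω hω
  rw [Pi.sub_apply, hω]
  exact sub_self _

/-- The mean of a signal under the transition law, when the observed levels are weighted with
the surrogate rewards. -/
theorem sum_transitionProb_mul (hC1 : ∀ j, ∑ k, C j k = 1) (hC : IsUnit C) (s : S) (a : A)
    (g : S → ℝ) :
    ∑ e, (surrogate C m.R e.2.2 + m.γ * g e.1) * transitionProb m C s a e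
      = m.meanReward s a + m.γ * ∑ s', m.P s a s' * g s' := by
  have hCR : ∀ i, ∑ j, C i j * surrogate C m.R j = m.R i := by
    intro i
    have : C *ᵥ surrogate C m.R = m.R := by
      rw [surrogate, Matrix.mulVec_mulVec,
        Matrix.mul_nonsing_inv _ ((Matrix.isUnit_iff_isUnit_det C).1 hC), Matrix.one_mulVec]
    exact congrFun this i
  have h1 : ∀ s' i, ∑ j, (surrogate C m.R j + m.γ * g s') *
      (m.P s a s' * m.rewardProb s a s' i * C i j)
      = m.P s a s' * (m.rewardProb s a s' i * m.R i)
        + m.γ * (m.P s a s' * g s') * m.rewardProb s a s' i := by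
    intro s' i
    calc _ = m.P s a s' * m.rewardProb s a s' i * (∑ j, C i j * surrogate C m.R j)
        + m.γ * (m.P s a s' * g s') * m.rewardProb s a s' i * ∑ j, C i j := by
          rw [Finset.mul_sum, Finset.mul_sum, ← Finset.sum_add_distrib]
          exact Finset.sum_congr rfl fun j _ => by ring
      _ = _ := by rw [hCR, hC1]; ring
  simp only [Fintype.sum_prod_type, transitionProb, h1, Finset.sum_add_distrib,
    ← Finset.mul_sum, m.rewardProb_sum, mul_one, FiniteMDP.meanReward]

end

end PerturbedQ

/-! ### Convergence of Q-learning with surrogate rewards -/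

theorem theorem1 {S A : Type*} [Fintype S] [DecidableEq S] [Fintype A] [Nonempty A]
    [DecidableEq A] {M : ℕ} (m : PerturbedQ.FiniteMDP S A M) (hγ : m.γ < 1)
    (C : Matrix (Fin M) (Fin M) ℝ) (hC_nonneg : ∀ j k, 0 ≤ C j k)
    (hC_sum : ∀ j, ∑ k, C j k = 1) (hC_inv : IsUnit C)
    {Ω : Type*} {mΩ : MeasurableSpace Ω} (μ : Measure Ω) [IsProbabilityMeasure μ]
    (ℱ : Filtration ℕ mΩ) (X : ℕ → Ω → S) (U : ℕ → Ω → A) (I J : ℕ → Ω → Fin M)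
    (hrun : PerturbedQ.IsPerturbedRun m C μ ℱ X U I J)
    (α : ℕ → Ω → ℝ) (hα_meas : ∀ t, Measurable[ℱ t] (α t))
    (hα_nonneg : ∀ᵐ ω ∂μ, ∀ t, 0 ≤ α t ω)
    (hα_sum : ∀ᵐ ω ∂μ, ∀ s a,
      Tendsto (fun n => ∑ t ∈ Finset.range n, if X t ω = s ∧ U t ω = a then α t ω else 0)
        atTop atTop)
    (hα_sq : ∀ᵐ ω ∂μ, Summable (fun t => α t ω ^ 2))
    (Q₀ : Ω → S → A → ℝ) (hQ₀ : ∀ s a, Measurable[ℱ 0] (fun ω => Q₀ ω s a)) :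
    ∀ᵐ ω ∂μ, ∀ s a,
      Tendsto (fun t => PerturbedQ.qLearning m.γ (PerturbedQ.surrogate C m.R) X U J α Q₀ t ω s a)
        atTop (𝓝 (m.optimalQ s a)) := by
  have hrhat := PerturbedQ.sum_transitionProb_mul (m := m) hC_sum hC_inv
  set rhat := PerturbedQ.surrogate C m.R
  set Q : ℕ → Ω → S → A → ℝ := PerturbedQ.qLearning m.γ rhat X U J α Q₀ with hQ
  set top : ℕ → Ω → S → ℝ := fun t ω s' =>
    Finset.univ.sup' Finset.univ_nonempty fun c => Q t ω s' c with htop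
  set D := PerturbedQ.transitionNoise m C X U I J with hD
  set a : ℕ → Ω → S × A → ℝ := fun t ω z =>
    if X t ω = z.1 ∧ U t ω = z.2 then α t ω else 0 with ha
  set β : S × A → S × Fin M × Fin M → ℕ → Ω → ℝ := fun z e t ω =>
    a t ω z * (rhat e.2.2 + m.γ * top t ω e.1) with hβ
  have hQm : ∀ t s a, Measurable[ℱ t] fun ω => Q t ω s a := by
    intro t
    induction t with
    | zero => exact hQ₀
    | succ t ih =>
      have up : (ℱ t : MeasurableSpace Ω) ≤ ℱ (t + 1) := ℱ.mono t.le_succ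
      exact PerturbedQ.measurable_qUpdate (mΩ := ℱ (t + 1)) ((hα_meas t).mono up le_rfl)
        (hrun.observed_meas t) ((hrun.state_meas t).mono up le_rfl) (hrun.state_meas (t + 1))
        ((hrun.action_meas t).mono up le_rfl) fun s a => (ih s a).mono up le_rfl
  have hβm : ∀ z e t, Measurable[ℱ t] (β z e t) := by
    intro z e t
    have h1 : MeasurableSet[ℱ t] {ω | X t ω = z.1} :=
      (hrun.state_meas t) (MeasurableSpace.measurableSet_top (s := {z.1}))
    have h2 : MeasurableSet[ℱ t] {ω | U t ω = z.2} :=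
      (hrun.action_meas t) (MeasurableSpace.measurableSet_top (s := {z.2}))
    have h3 : Measurable[ℱ t] fun ω => top t ω e.1 :=
      @measurable_sup'_univ _ _ _ _ (ℱ t) _ fun c => hQm t e.1 c
    exact (Measurable.ite (h1.inter h2) (hα_meas t) measurable_const).mul
      (measurable_const.add (h3.const_mul _))
  have ha_le : ∀ t ω z, |a t ω z| ≤ |α t ω| := fun t ω z => by
    simp only [ha]
    split_ifs <;> simp
  -- Both the bound `K` and the time after which the steps are at most `1` depend on the path, so
  -- the weights `β` are only almost surely square summable.
  have hregular : ∀ᵐ ω ∂μ, (∀ t, 0 ≤ α t ω) ∧ (Summable fun t => α t ω ^ 2) ∧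
      (∀ᶠ t in atTop, α t ω ≤ 1) ∧
      ∃ K, 0 ≤ K ∧ ∀ᶠ t in atTop, ∀ s a, |Q t ω s a| ≤ K := by
    filter_upwards [hα_nonneg, hα_sq] with ω h0 h2
    have h1 : ∀ᶠ t in atTop, α t ω ≤ 1 := by
      filter_upwards [h2.tendsto_atTop_zero.eventually (gt_mem_nhds one_pos)] with t ht
      exact ((sq_lt_one_iff₀ (h0 t)).1 ht).le
    exact ⟨h0, h2, h1,
      PerturbedQ.qLearning_eventually_bounded m.γ_nonneg hγ rhat X U J α Q₀ h0 h1⟩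
  have hβ_sq : ∀ z e, ∀ᵐ ω ∂μ, Summable fun t => β z e t ω ^ 2 := by
    intro z e
    filter_upwards [hregular] with ω ⟨_, h2, _, K, hK0, hK⟩
    refine Summable.of_norm_bounded_eventually_nat
      (g := fun t => (|rhat e.2.2| + m.γ * K) ^ 2 * α t ω ^ 2) (h2.mul_left _) ?_
    filter_upwards [hK] with t ht
    have htop_le : |top t ω e.1| ≤ K := by
      obtain ⟨c, -, hc⟩ := Finset.exists_mem_eq_sup' Finset.univ_nonempty fun c => Q t ω e.1 c
      simp only [htop, hc]
      exact ht _ _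
    have hsig : |rhat e.2.2 + m.γ * top t ω e.1| ≤ |rhat e.2.2| + m.γ * K := by
      refine (abs_add_le _ _).trans ?_
      rw [abs_mul, abs_of_nonneg m.γ_nonneg]
      exact add_le_add le_rfl (mul_le_mul_of_nonneg_left htop_le m.γ_nonneg)
    rw [Real.norm_eq_abs, abs_pow, ← sq_abs (α t ω), ← mul_pow]
    refine pow_le_pow_left₀ (abs_nonneg _) ?_ 2
    simp only [hβ, abs_mul]
    rw [mul_comm]
    exact mul_le_mul hsig (ha_le t ω z) (abs_nonneg _) ((abs_nonneg _).trans hsig)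
  have hnoise : ∀ᵐ ω ∂μ, ∀ z e, ∃ l,
      Tendsto (fun n => ∑ t ∈ Finset.range n, β z e t ω * D e t ω) atTop (𝓝 l) :=
    ae_all_iff.2 fun z => ae_all_iff.2 fun e =>
      ae_tendsto_weighted_sum (hβm z e) (PerturbedQ.measurable_transitionNoise hrun e)
        (PerturbedQ.abs_transitionNoise_le hC_nonneg hC_sum e)
        (PerturbedQ.condExp_transitionNoise hC_nonneg hC_sum hrun e) (hβ_sq z e)
  obtain ⟨q, hq⟩ := m.exists_bellman_fixedPoint hγ
  filter_upwards [hregular, hα_sum, hnoise] with ω ⟨h0, _, h1, K, hK0, hK⟩ hsum hconv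
  have ha0 : ∀ t z, 0 ≤ a t ω z := fun t z => by
    simp only [ha]
    split_ifs
    exacts [h0 t, le_rfl]
  have hmain : Tendsto (fun t (z : S × A) => Q t ω z.1 z.2) atTop (𝓝 q) := by
    refine tendsto_of_asynchronous_approximation (T := m.bellman) (a := fun t z => a t ω z)
      (w := fun t _ => ∑ e, (rhat e.2.2 + m.γ * top t ω e.1) * D e t ω) m.γ_nonneg hγ
      m.norm_bellman_sub_le hq ha0 ?_ (fun z => hsum z.1 z.2) (B := K) ?_ ?_ ?_
    · filter_upwards [h1] with t ht z
      exact (le_abs_self _).trans ((ha_le t ω z).trans (by rwa [abs_of_nonneg (h0 t)]))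
    · filter_upwards [hK] with t ht
      exact (pi_norm_le_iff_of_nonneg hK0).2 fun z => ht z.1 z.2
    · intro z
      choose l hl using hconv z
      refine ⟨∑ e, l e, (tendsto_finsetSum _ fun e _ => hl e).congr fun n => ?_⟩
      rw [Finset.sum_comm]
      refine Finset.sum_congr rfl fun t _ => ?_
      rw [Finset.mul_sum]
      exact Finset.sum_congr rfl fun e _ => mul_assoc _ _ _
    · intro t z
      have hstep : Q (t + 1) ω = PerturbedQ.qUpdate m.γ (α t ω) (rhat (J t ω)) (X t ω) (U t ω)
        (X (t + 1) ω) (Q t ω) := rfl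
      rw [hstep, PerturbedQ.qUpdate]
      by_cases hz : z.1 = X t ω ∧ z.2 = U t ω
      · have haz : a t ω z = α t ω := if_pos ⟨hz.1.symm, hz.2.symm⟩
        -- Exactly one outcome occurs, so the sum of indicators picks out the observed target;
        -- subtracting the conditional mean then leaves target minus Bellman value.
        have hind : ∑ e : S × Fin M × Fin M, (rhat e.2.2 + m.γ * top t ω e.1) *
            Set.indicator {ω | X (t + 1) ω = e.1 ∧ I t ω = e.2.1 ∧ J t ω = e.2.2}
              (fun _ => (1 : ℝ)) ω = rhat (J t ω) + m.γ * top t ω (X (t + 1) ω) := by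
          rw [Finset.sum_eq_single (X (t + 1) ω, I t ω, J t ω)]
          · simp
          · intro e _ he
            rw [Set.indicator_of_notMem, mul_zero]
            rintro ⟨h1, h2, h3⟩
            exact he (by rw [h1, h2, h3])
          · simp
        have hw : ∑ e, (rhat e.2.2 + m.γ * top t ω e.1) * D e t ω
            = rhat (J t ω) + m.γ * top t ω (X (t + 1) ω)
              - m.bellman (fun z => Q t ω z.1 z.2) z := by
          simp only [hD, PerturbedQ.transitionNoise, mul_sub, Finset.sum_sub_distrib, hind]
          rw [hrhat, PerturbedQ.FiniteMDP.bellman, hz.1, hz.2]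
        rw [if_pos hz, hw, haz, hz.1, hz.2]
        simp only [htop]
        ring
      -- For a pair not visited at time `t` the step is zero, so the value of the noise there is
      -- irrelevant.
      · have haz : a t ω z = 0 := if_neg fun h => hz ⟨h.1.symm, h.2.symm⟩
        rw [if_neg hz, haz]
        ring
  intro s b
  rw [m.optimalQ_eq_of_bellman_fixedPoint hγ hq]
  exact (tendsto_pi_nhds.1 hmain) (s, b)
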